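/- Let $\ell>0$ and let $\mu$ be a measurable rate function on $(0,\infty)$ with $\mu(t)>0$ for Lebesgue-almost all $t>0$ and $\int_0^t\mu(s)\,ds<\infty$ for every $t<\infty$. Let $\mathcal N$ be an inhomogeneous Poisson point process on $(0,\infty)$ with rate function $\mu$, that is, with intensity measure $\mu(t)\,dt$. Let $0<T_1<T_2<\cdots$ be its epochs, put $T_0=0$, and put $T_{n+1}=\infty$ if $\mathcal N$ has only $n$ points. Let \[D=\min\{T_n : n\ge 0,\ T_n<\infty,\ T_{n+1}-T_n\ge \ell\}\] be the first epoch that is followed by a gap of length at least $\ell$, with $D=\infty$ if there is no such epoch. Then: (i) If $\limsup_{t\to\infty}\mu(t)/\log t<1/\ell$, then $D<\infty$ almost surely. (ii) If $\liminf_{t\to\infty}\mu(t)/\log t>1/\ell$, then $\mathbb P(D=\infty)>0$. -/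

import Mathlib

open MeasureTheory ProbabilityTheory Filter Set

noncomputable section

namespace PoissonGap

/-- The intensity measure `M(dt) = μ(t) dt` on `(0, ∞)` with rate function `μ`. -/
def intensity (μ : ℝ → ℝ) : Measure ℝ :=
  (volume.restrict (Ioi 0)).withDensity fun t => ENNReal.ofReal (μ t)

/-- The number of points of the configuration `S` in the set `A`. -/
def count (S A : Set ℝ) : ℕ∞ := (S ∩ A).encard

/-- The random subset `N` of `(0, ∞)` is a Poisson point process with intensity measure `M`:
the numbers of points in Borel sets are random variables, the number of points in a set of finite
intensity is Poisson distributed with mean the intensity of the set, and the numbers of points in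
finitely many disjoint sets are independent. -/
structure IsPoissonProcess {Ω : Type*} [MeasurableSpace Ω] (P : Measure Ω)
    (N : Ω → Set ℝ) (M : Measure ℝ) : Prop where
  subset_Ioi : ∀ ω, N ω ⊆ Ioi 0
  measurable_count : ∀ A : Set ℝ, MeasurableSet A → Measurable fun ω => count (N ω) A
  map_count : ∀ A : Set ℝ, MeasurableSet A → M A ≠ ⊤ →
    P.map (fun ω => count (N ω) A) = (poissonMeasure (M A).toNNReal).map (fun k : ℕ => (k : ℕ∞))
  iIndepFun_count : ∀ (n : ℕ) (A : Fin n → Set ℝ), (∀ i, MeasurableSet (A i)) →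
    Pairwise (fun i j => Disjoint (A i) (A j)) →
    iIndepFun (fun i ω => count (N ω) (A i)) P

/-- The epochs `0 = T₀ < T₁ < T₂ < ⋯` of a locally finite subset `S` of `(0, ∞)`: `Tₙ₊₁` is the
first point of `S` after `Tₙ`, and `Tₙ₊₁ = ∞` if there is no such point. -/
def epoch (S : Set ℝ) : ℕ → ENNReal
  | 0 => 0
  | n + 1 => sInf {x | ∃ t ∈ S, x = ENNReal.ofReal t ∧ epoch S n < x}

/-- The first (finite) epoch `Tₙ`, `n ≥ 0`, that is followed by a gap of length at least `ℓ`,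
that is `Tₙ₊₁ - Tₙ ≥ ℓ`; it is `∞` if there is no such epoch. -/
def firstGap (ℓ : ℝ) (S : Set ℝ) : ENNReal :=
  sInf {x | ∃ n, x = epoch S n ∧ epoch S n < ⊤ ∧
    epoch S n + ENNReal.ofReal ℓ ≤ epoch S (n + 1)}

end PoissonGap

end

namespace PoissonGap

open scoped ENNReal

/-! Cut $(0,\infty)$ into cells of length $\delta$. They are independent, and if $\mu(t)\approx
c\log t$ then cell $i$ is empty with probability about $(i\delta)^{-c\delta}$. (i) Take
$\delta=\ell$, $c\ell<1$: these probabilities have infinite sum, so by the second Borel–Cantelli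
lemma some cell is empty, which forces a gap (`firstGap_lt_top`). (ii) Take $\delta=\ell/(r+1)$,
$c\ell>1$: a gap of length $\ell$ after an epoch contains $r$ consecutive empty cells
(`firstGap_eq_top`). Such a window has probability about $i^{-c\delta r}$, summable for large $r$.
Late windows thus all contain points with positive probability; independently, so do the finitely
many early cells. -/

/-- A bounded interval of length `ℓ` without points of a locally finite configuration forces a gap
of length at least `ℓ`. -/
theorem firstGap_lt_top {ℓ a : ℝ} (hℓ : 0 < ℓ) (ha : 0 ≤ a) {S : Set ℝ}
    (hfin : (S ∩ Ioc 0 a).Finite) (hS : S ⊆ Ioi 0) (hgap : S ∩ Ioc a (a + ℓ) = ∅) :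
    firstGap ℓ S < ⊤ := by
  -- Induction on the number of points in $(T_n,a]$: if there are none, $T_{n+1}$ lies beyond the
  -- gap (possibly at $\infty$); otherwise $T_{n+1}\le a$ and the number drops.
  suffices key : ∀ (m : ℕ) (n : ℕ), epoch S n ≤ ENNReal.ofReal a →
      {t ∈ S ∩ Ioc 0 a | epoch S n < ENNReal.ofReal t}.ncard = m →
      ∃ k, epoch S k ≤ ENNReal.ofReal a ∧ ENNReal.ofReal (a + ℓ) ≤ epoch S (k + 1) by
    obtain ⟨k, hk, hk'⟩ := key _ 0 (by simp [epoch]) rfl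
    have hlt : epoch S k < ⊤ := hk.trans_lt ENNReal.ofReal_lt_top
    refine lt_of_le_of_lt (sInf_le ⟨k, rfl, hlt, ?_⟩) hlt
    refine le_trans ?_ hk'
    rw [ENNReal.ofReal_add ha hℓ.le]
    gcongr
  intro m
  induction m using Nat.strong_induction_on with
  | _ m ih =>
    intro n hn hm
    set G := {t ∈ S ∩ Ioc 0 a | epoch S n < ENNReal.ofReal t} with hG
    have hGfin : G.Finite := hfin.subset (sep_subset _ _)
    have far : ∀ t ∈ S, a < t → a + ℓ ≤ t := by
      intro t ht hat
      by_contra! h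
      exact (hgap ▸ (⟨ht, hat, h.le⟩ : t ∈ S ∩ Ioc a (a + ℓ)) : t ∈ (∅ : Set ℝ))
    rcases G.eq_empty_or_nonempty with hemp | hne
    · refine ⟨n, hn, le_sInf ?_⟩
      rintro x ⟨t, ht, rfl, hlt⟩
      refine ENNReal.ofReal_le_ofReal (far t ht ?_)
      by_contra! hta
      have : t ∈ G := ⟨⟨ht, hS ht, hta⟩, hlt⟩
      simp [hemp] at this
    · obtain ⟨g, hgG, hgmin⟩ := hGfin.exists_minimalFor id G hne
      have hmin : ∀ t ∈ G, g ≤ t := fun t ht => by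
        rcases le_total g t with h | h
        · exact h
        · exact hgmin ht h
      have hnext : epoch S (n + 1) = ENNReal.ofReal g := by
        refine le_antisymm (sInf_le ⟨g, hgG.1.1, rfl, hgG.2⟩) (le_sInf ?_)
        rintro x ⟨t, ht, rfl, hlt⟩
        refine ENNReal.ofReal_le_ofReal ?_
        by_cases hta : t ≤ a
        · exact hmin t ⟨⟨ht, hS ht, hta⟩, hlt⟩
        · exact hgG.1.2.2.trans (not_le.1 hta).le
      refine ih _ ?_ (n + 1) (hnext ▸ ENNReal.ofReal_le_ofReal hgG.1.2.2) rfl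
      rw [← hm]
      refine ncard_lt_ncard ⟨fun t ht => ⟨ht.1, ?_⟩, fun h => ?_⟩ hGfin
      · exact hgG.2.trans (hnext ▸ ht.2)
      · exact absurd (hnext ▸ (h hgG).2) (lt_irrefl _)

/-! ### Grid cells -/

/-- The `i`-th cell of the grid of mesh `δ`. -/
def cell (δ : ℝ) (i : ℕ) : Set ℝ := Ioc (i * δ) ((i + 1) * δ)

theorem measurableSet_cell (δ : ℝ) (i : ℕ) : MeasurableSet (cell δ i) := measurableSet_Ioc

theorem cell_subset_Ioo {δ : ℝ} (hδ : 0 < δ) (i : ℕ) : cell δ i ⊆ Ioo 0 ((i + 2) * δ) := by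
  intro t ht
  have : (0 : ℝ) ≤ i * δ := by positivity
  exact ⟨this.trans_lt ht.1, ht.2.trans_lt (by nlinarith)⟩

theorem pairwise_disjoint_cell {δ : ℝ} (hδ : 0 < δ) :
    Pairwise fun i j => Disjoint (cell δ i) (cell δ j) := by
  have key : ∀ i j : ℕ, i < j → Disjoint (cell δ i) (cell δ j) := by
    intro i j hij
    refine Set.disjoint_left.2 fun t hi hj => ?_
    have h : ((i : ℝ) + 1) ≤ j := by exact_mod_cast hij
    exact absurd hj.1 (not_lt.2 (hi.2.trans (mul_le_mul_of_nonneg_right h hδ.le)))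
  intro i j hij
  rcases lt_or_gt_of_ne hij with h | h
  · exact key i j h
  · exact (key j i h).symm

/-- If every window of `r` consecutive cells of mesh `ℓ / (r + 1)` contains a point, then no epoch
is followed by a gap of length at least `ℓ`. -/
theorem firstGap_eq_top {ℓ : ℝ} (hℓ : 0 < ℓ) {r : ℕ} {S : Set ℝ}
    (h : ∀ i : ℕ, ∃ j ∈ Finset.Ico i (i + r), (S ∩ cell (ℓ / (r + 1)) j).Nonempty) :
    firstGap ℓ S = ⊤ := by
  refine sInf_eq_top.2 ?_
  rintro _ ⟨n, rfl, hlt, hgap⟩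
  exfalso
  set δ := ℓ / (r + 1) with hδ
  have hδ0 : 0 < δ := by positivity
  have hδℓ : (r + 1) * δ = ℓ := by rw [hδ]; field_simp
  set x := (epoch S n).toReal with hx
  have hTx : epoch S n = ENNReal.ofReal x := (ENNReal.ofReal_toReal hlt.ne).symm
  have hx0 : 0 ≤ x := ENNReal.toReal_nonneg
  -- Rounding $x$ up to the grid costs less than $\delta$, so the $r$ cells from there end before
  -- $x+\delta+r\delta=x+\ell$.
  obtain ⟨j, hj, s, hsS, hs1, hs2⟩ := h ⌈x / δ⌉₊
  rw [Finset.mem_Ico] at hj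
  have h1 : x ≤ ⌈x / δ⌉₊ * δ := (div_le_iff₀ hδ0).1 (Nat.le_ceil _)
  have h2 : (⌈x / δ⌉₊ : ℝ) * δ < x + δ := by
    have := mul_lt_mul_of_pos_right (Nat.ceil_lt_add_one (div_nonneg hx0 hδ0.le)) hδ0
    rwa [add_mul, one_mul, div_mul_cancel₀ _ hδ0.ne'] at this
  have h3 : ((⌈x / δ⌉₊ : ℕ) : ℝ) ≤ j := by exact_mod_cast hj.1
  have h4 : (j : ℝ) + 1 ≤ (⌈x / δ⌉₊ : ℕ) + r := by exact_mod_cast hj.2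
  have hxs : x < s := by nlinarith
  have hsx : s < x + ℓ := by nlinarith
  have : epoch S (n + 1) ≤ ENNReal.ofReal s := by
    refine sInf_le ⟨s, hsS, rfl, ?_⟩
    rw [hTx]
    exact (ENNReal.ofReal_lt_ofReal_iff (hx0.trans_lt hxs)).2 hxs
  refine absurd (hgap.trans this) (not_le.2 ?_)
  rw [hTx, ← ENNReal.ofReal_add hx0 hℓ.le]
  exact (ENNReal.ofReal_lt_ofReal_iff (by linarith)).2 hsx

/-! ### Intensity of a cell -/

section Intensity

variable {μ : ℝ → ℝ}

theorem intensity_apply_of_subset {A : Set ℝ} (hA : MeasurableSet A) (h0 : A ⊆ Ioi 0) :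
    intensity μ A = ∫⁻ t in A, ENNReal.ofReal (μ t) := by
  rw [intensity, withDensity_apply _ hA, Measure.restrict_restrict hA, inter_eq_left.2 h0]

theorem cell_subset_Ioi {δ : ℝ} (hδ : 0 < δ) (i : ℕ) : cell δ i ⊆ Ioi 0 :=
  fun _ ht => (cell_subset_Ioo hδ i ht).1

theorem volume_cell (δ : ℝ) (i : ℕ) : volume (cell δ i) = ENNReal.ofReal δ := by
  rw [cell, Real.volume_Ioc]; congr 1; ring

theorem intensity_cell_ne_top (hfin : ∀ t : ℝ, intensity μ (Ioo 0 t) < ⊤) {δ : ℝ} (hδ : 0 < δ)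
    (i : ℕ) : intensity μ (cell δ i) ≠ ⊤ :=
  ((measure_mono (cell_subset_Ioo hδ i)).trans_lt (hfin _)).ne

theorem intensity_cell_pos (hμ : Measurable μ)
    (hpos : ∀ᵐ t ∂(volume.restrict (Ioi (0 : ℝ))), 0 < μ t) {δ : ℝ} (hδ : 0 < δ) (i : ℕ) :
    0 < intensity μ (cell δ i) := by
  rw [intensity_apply_of_subset (measurableSet_cell δ i) (cell_subset_Ioi hδ i), pos_iff_ne_zero]
  intro h0
  rw [lintegral_eq_zero_iff hμ.ennreal_ofReal] at h0
  have hpos' := ae_restrict_of_ae_restrict_of_subset (cell_subset_Ioi hδ i) hpos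
  have hF : ∀ᵐ t ∂(volume.restrict (cell δ i)), False := by
    filter_upwards [h0, hpos'] with t h1 h2
    exact absurd (ENNReal.ofReal_eq_zero.1 h1) (not_le.2 h2)
  rw [ae_iff] at hF
  simp [volume_cell] at hF
  linarith

theorem le_intensity_cell {c δ : ℝ} (hδ : 0 < δ) {i : ℕ}
    (h : ∀ t ∈ cell δ i, c ≤ μ t) : ENNReal.ofReal (c * δ) ≤ intensity μ (cell δ i) := by
  rw [intensity_apply_of_subset (measurableSet_cell δ i) (cell_subset_Ioi hδ i),
    ENNReal.ofReal_mul' hδ.le, ← volume_cell δ i, ← setLIntegral_const]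
  exact setLIntegral_mono' (measurableSet_cell δ i) fun t ht => ENNReal.ofReal_le_ofReal (h t ht)

theorem intensity_cell_le {c δ : ℝ} (hδ : 0 < δ) {i : ℕ}
    (h : ∀ t ∈ cell δ i, μ t ≤ c) : intensity μ (cell δ i) ≤ ENNReal.ofReal (c * δ) := by
  rw [intensity_apply_of_subset (measurableSet_cell δ i) (cell_subset_Ioi hδ i),
    ENNReal.ofReal_mul' hδ.le, ← volume_cell δ i, ← setLIntegral_const]
  exact setLIntegral_mono' (measurableSet_cell δ i) fun t ht => ENNReal.ofReal_le_ofReal (h t ht)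

end Intensity

/-- The event that the `i`-th cell contains no point. -/
def emptyCell {Ω : Type*} (N : Ω → Set ℝ) (δ : ℝ) (i : ℕ) : Set Ω := {ω | count (N ω) (cell δ i) = 0}

theorem mem_emptyCell {Ω : Type*} {N : Ω → Set ℝ} {δ : ℝ} {i : ℕ} {ω : Ω} : ω ∈ emptyCell N δ i ↔ N ω ∩ cell δ i = ∅ := by
  simp [emptyCell, count]

/-! ### Void probabilities and independence of cells -/

section Poisson

variable {Ω : Type*} [MeasurableSpace Ω] {P : Measure Ω} {N : Ω → Set ℝ} {M : Measure ℝ}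

theorem IsPoissonProcess.measure_count_eq_zero (hN : IsPoissonProcess P N M) {A : Set ℝ}
    (hA : MeasurableSet A) (hfin : M A ≠ ⊤) :
    P {ω | count (N ω) A = 0} = ENNReal.ofReal (Real.exp (-(M A).toReal)) := by
  have h := congrArg (fun ν => ν {(0 : ℕ∞)}) (hN.map_count A hA hfin)
  rw [Measure.map_apply (hN.measurable_count A hA) (measurableSet_singleton _),
    Measure.map_apply .of_discrete (measurableSet_singleton _)] at h
  have h0 : (fun k : ℕ => (k : ℕ∞)) ⁻¹' {0} = {0} := by ext; simp
  rw [h0, poissonMeasure_singleton] at h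
  simpa [preimage, ENNReal.coe_toNNReal_eq_toReal] using h

theorem IsPoissonProcess.ae_finite (hN : IsPoissonProcess P N M) {A : Set ℝ}
    (hA : MeasurableSet A) (hfin : M A ≠ ⊤) : ∀ᵐ ω ∂P, (N ω ∩ A).Finite := by
  have h := congrArg (fun ν => ν {(⊤ : ℕ∞)}) (hN.map_count A hA hfin)
  rw [Measure.map_apply (hN.measurable_count A hA) (measurableSet_singleton _),
    Measure.map_apply .of_discrete (measurableSet_singleton _)] at h
  have h0 : (fun k : ℕ => (k : ℕ∞)) ⁻¹' {⊤} = ∅ := by ext; simp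
  rw [h0, measure_empty] at h
  rw [ae_iff]
  convert h using 2
  ext ω
  simp [count]

theorem IsPoissonProcess.measurableSet_emptyCell (hN : IsPoissonProcess P N M) (δ : ℝ) (i : ℕ) :
    MeasurableSet (emptyCell N δ i) :=
  hN.measurable_count _ (measurableSet_cell δ i) (measurableSet_singleton 0)

theorem IsPoissonProcess.iIndepSet_emptyCell (hN : IsPoissonProcess P N M) {δ : ℝ} (hδ : 0 < δ) :
    iIndepSet (emptyCell N δ) P := by
  rw [iIndepSet_iff_meas_biInter fun i => hN.measurableSet_emptyCell δ i]
  have hind : iIndepFun (fun i ω => count (N ω) (cell δ i)) P := by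
    -- Independence is given only for families indexed by `Fin n`; each finite set of indices embeds
    -- in one.
    rw [iIndepFun_iff_finset]
    intro s
    obtain ⟨n, hn⟩ : ∃ n, ∀ i ∈ s, i < n :=
      ⟨s.sup id + 1, fun i hi => Nat.lt_succ_of_le (Finset.le_sup (f := id) hi)⟩
    have h := hN.iIndepFun_count n (fun i => cell δ i) (fun i => measurableSet_cell δ i)
      fun i j hij => pairwise_disjoint_cell hδ fun h => hij (Fin.ext h)
    let g : s → Fin n := fun i => ⟨i, hn i i.2⟩
    have hg : Function.Injective g := fun i j hij => Subtype.ext (Fin.mk.inj_iff.1 hij)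
    have h' : iIndepFun (fun (i : s) ω => count (N ω) (cell δ i)) P := h.precomp hg
    exact h'
  intro s
  exact hind.measure_inter_preimage_eq_mul s (sets := fun _ => {0})
    fun i _ => measurableSet_singleton 0

end Poisson

/-! ### Borel–Cantelli estimates and the two halves -/

section Asymptotics

variable {Ω : Type*} [MeasurableSpace Ω] {P : Measure Ω} {N : Ω → Set ℝ} {μ : ℝ → ℝ}

theorem exp_neg_mul_log_mul {x : ℝ} (hx : 0 < x) (c δ : ℝ) :
    Real.exp (-(c * Real.log x * δ)) = x ^ (-(c * δ)) := by
  rw [Real.rpow_def_of_pos hx]; ring_nf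

/-- As $\log$ increases, the left endpoint gives the bound; the converse estimate uses the right
one. -/
theorem measure_emptyCell_le (hfin : ∀ t : ℝ, intensity μ (Ioo 0 t) < ⊤)
    (hN : IsPoissonProcess P N (intensity μ)) {c δ : ℝ} (hc : 0 ≤ c) (hδ : 0 < δ)
    {i : ℕ} (hi : 0 < i) (h : ∀ t, i * δ < t → c * Real.log t ≤ μ t) :
    P (emptyCell N δ i) ≤ ENNReal.ofReal ((i * δ) ^ (-(c * δ))) := by
  have hx : 0 < (i : ℝ) * δ := by positivity
  rw [emptyCell, hN.measure_count_eq_zero (measurableSet_cell δ i)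
    (intensity_cell_ne_top hfin hδ i), ← exp_neg_mul_log_mul hx]
  refine ENNReal.ofReal_le_ofReal (Real.exp_le_exp.2 (neg_le_neg ?_))
  refine (ENNReal.ofReal_le_iff_le_toReal (intensity_cell_ne_top hfin hδ i)).1
    (le_intensity_cell hδ fun t ht => ?_)
  exact (mul_le_mul_of_nonneg_left (Real.log_le_log hx ht.1.le) hc).trans (h t ht.1)

theorem le_measure_emptyCell (hfin : ∀ t : ℝ, intensity μ (Ioo 0 t) < ⊤)
    (hN : IsPoissonProcess P N (intensity μ)) {c δ : ℝ} (hc : 0 ≤ c) (hδ : 0 < δ)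
    {i : ℕ} (hi : 1 ≤ i * δ) (h : ∀ t, i * δ < t → μ t ≤ c * Real.log t) :
    ENNReal.ofReal (((i + 1) * δ) ^ (-(c * δ))) ≤ P (emptyCell N δ i) := by
  have hx : 1 ≤ ((i : ℝ) + 1) * δ := by nlinarith
  rw [emptyCell, hN.measure_count_eq_zero (measurableSet_cell δ i)
    (intensity_cell_ne_top hfin hδ i), ← exp_neg_mul_log_mul (by linarith)]
  refine ENNReal.ofReal_le_ofReal (Real.exp_le_exp.2 (neg_le_neg ?_))
  refine ENNReal.toReal_le_of_le_ofReal (by have := Real.log_nonneg hx; positivity)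
    (intensity_cell_le hδ fun t ht => ?_)
  have ht0 : 0 < t := by linarith [ht.1]
  exact (h t ht.1).trans (mul_le_mul_of_nonneg_left (Real.log_le_log ht0 ht.2) hc)

theorem ae_frequently_mem_emptyCell (hfin : ∀ t : ℝ, intensity μ (Ioo 0 t) < ⊤)
    (hN : IsPoissonProcess P N (intensity μ)) {c δ : ℝ} (hc : 0 ≤ c) (hδ : 0 < δ)
    (hcδ : c * δ < 1) (h : ∀ᶠ t in atTop, μ t ≤ c * Real.log t) :
    ∀ᵐ ω ∂P, ∃ᶠ i in atTop, ω ∈ emptyCell N δ i := by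
  have hind := hN.iIndepSet_emptyCell hδ
  have : IsProbabilityMeasure P := hind.isProbabilityMeasure
  obtain ⟨t₀, ht₀⟩ := eventually_atTop.1 h
  obtain ⟨J, hJ⟩ : ∃ J : ℕ, max t₀ 1 ≤ J * δ := by
    obtain ⟨J, hJ⟩ := exists_nat_ge (max t₀ 1 / δ)
    exact ⟨J, (div_le_iff₀ hδ).1 hJ⟩
  have hJi : ∀ i : ℕ, max t₀ 1 ≤ ((i + J : ℕ) : ℝ) * δ := fun i => by
    push_cast; nlinarith [(Nat.cast_nonneg i : (0 : ℝ) ≤ i)]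
  -- A finite sum would make a $p$-series with exponent $c\delta<1$ converge.
  have hsum : ∑' i, P (emptyCell N δ i) = ∞ := by
    by_contra hne
    have hs : Summable fun i => (P (emptyCell N δ i)).toReal := ENNReal.summable_toReal hne
    have hs' := (summable_nat_add_iff J).2 hs
    have hs2 : Summable fun i : ℕ => (((i + J + 1 : ℕ) : ℝ) * δ) ^ (-(c * δ)) := by
      refine Summable.of_nonneg_of_le (fun i => by positivity) (fun i => ?_) hs'
      have := le_measure_emptyCell hfin hN hc hδ ((le_max_right _ _).trans (hJi i))
        fun t ht => ht₀ t (((le_max_left _ _).trans (hJi i)).trans ht.le)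
      have := (ENNReal.ofReal_le_iff_le_toReal (measure_ne_top _ _)).1 this
      exact_mod_cast this
    have hs3 : Summable fun i : ℕ => ((i : ℝ) * δ) ^ (-(c * δ)) :=
      (summable_nat_add_iff (f := fun i : ℕ => ((i : ℝ) * δ) ^ (-(c * δ))) (J + 1)).1 hs2
    rw [funext fun i : ℕ => Real.mul_rpow (z := -(c * δ)) (Nat.cast_nonneg i) hδ.le,
      summable_mul_right_iff (by positivity), Real.summable_nat_rpow] at hs3
    linarith
  have h1 := measure_limsup_eq_one (hN.measurableSet_emptyCell δ) hind hsum
  have hmeas : MeasurableSet (limsup (emptyCell N δ) atTop) :=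
    .measurableSet_limsup (hN.measurableSet_emptyCell δ)
  have h2 : ∀ᵐ ω ∂P, ω ∈ limsup (emptyCell N δ) atTop := (prob_compl_eq_zero_iff hmeas).2 h1
  filter_upwards [h2] with ω hω
  exact mem_limsup_iff_frequently_mem.1 hω

/-- If the rate is eventually at most `c * log t` with `c * ℓ < 1`, then almost surely some epoch
is followed by a gap of length at least `ℓ`. -/
theorem ae_firstGap_lt_top (hfin : ∀ t : ℝ, intensity μ (Ioo 0 t) < ⊤)
    (hN : IsPoissonProcess P N (intensity μ)) {c ℓ : ℝ} (hc : 0 ≤ c) (hℓ : 0 < ℓ)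
    (hcℓ : c * ℓ < 1) (h : ∀ᶠ t in atTop, μ t ≤ c * Real.log t) :
    ∀ᵐ ω ∂P, firstGap ℓ (N ω) < ⊤ := by
  have hloc : ∀ᵐ ω ∂P, ∀ i : ℕ, (N ω ∩ Ioc 0 (i * ℓ)).Finite := by
    refine ae_all_iff.2 fun i => hN.ae_finite measurableSet_Ioc ?_
    refine ((measure_mono fun t ht => ?_).trans_lt (hfin (i * ℓ + 1))).ne
    exact ⟨ht.1, ht.2.trans_lt (lt_add_one _)⟩
  filter_upwards [ae_frequently_mem_emptyCell hfin hN hc hℓ hcℓ h, hloc] with ω hω hfinω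
  obtain ⟨i, hi⟩ := hω.exists
  refine firstGap_lt_top hℓ (a := i * ℓ) (by positivity) (hfinω i) (hN.subset_Ioi ω) ?_
  have := mem_emptyCell.1 hi
  rwa [cell, add_mul, one_mul] at this

theorem summable_measure_iInter_emptyCell (hfin : ∀ t : ℝ, intensity μ (Ioo 0 t) < ⊤)
    (hN : IsPoissonProcess P N (intensity μ)) {c δ : ℝ} (hc : 0 ≤ c) (hδ : 0 < δ) {r : ℕ}
    (hcδ : 1 < c * δ * r) (h : ∀ᶠ t in atTop, c * Real.log t ≤ μ t) :
    ∃ J, ∑' i, P (⋂ j ∈ Finset.Ico (i + J) (i + J + r), emptyCell N δ j) ≠ ∞ := by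
  have hind := hN.iIndepSet_emptyCell hδ
  obtain ⟨t₀, ht₀⟩ := eventually_atTop.1 h
  obtain ⟨J, hJ⟩ : ∃ J : ℕ, t₀ ≤ J * δ := by
    obtain ⟨J, hJ⟩ := exists_nat_ge (t₀ / δ)
    exact ⟨J, (div_le_iff₀ hδ).1 hJ⟩
  -- The extra $1$ keeps windows away from the origin, so that $k\delta>0$.
  refine ⟨J + 1, ?_⟩
  have hs : Summable fun i : ℕ => (((i + (J + 1) : ℕ) : ℝ) * δ) ^ (-(c * δ * r)) := by
    refine (summable_nat_add_iff (f := fun i : ℕ => ((i : ℝ) * δ) ^ (-(c * δ * r))) (J + 1)).2 ?_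
    rw [funext fun i : ℕ => Real.mul_rpow (z := -(c * δ * r)) (Nat.cast_nonneg i) hδ.le]
    exact (Real.summable_nat_rpow.2 (by linarith)).mul_right _
  refine ne_top_of_le_ne_top hs.tsum_ofReal_ne_top (ENNReal.tsum_le_tsum fun i => ?_)
  set k := i + (J + 1) with hk
  have hk0 : 0 < (k : ℝ) * δ := by
    have : 0 < k := by omega
    positivity
  have hcell : ∀ j ∈ Finset.Ico k (k + r),
      P (emptyCell N δ j) ≤ ENNReal.ofReal ((k * δ) ^ (-(c * δ))) := by
    intro j hj
    have hkj := (Finset.mem_Ico.1 hj).1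
    have hkjδ : (k : ℝ) * δ ≤ j * δ := by gcongr
    have hJj : (J : ℝ) * δ ≤ j * δ := by
      have : J ≤ j := by omega
      gcongr
    refine (measure_emptyCell_le hfin hN hc hδ (by omega)
      fun t ht => ht₀ t ((hJ.trans hJj).trans ht.le)).trans (ENNReal.ofReal_le_ofReal ?_)
    exact Real.rpow_le_rpow_of_nonpos hk0 hkjδ (neg_nonpos.2 (by positivity))
  calc P (⋂ j ∈ Finset.Ico k (k + r), emptyCell N δ j)
      = ∏ j ∈ Finset.Ico k (k + r), P (emptyCell N δ j) := hind.meas_biInter _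
    _ ≤ ∏ _j ∈ Finset.Ico k (k + r), ENNReal.ofReal ((k * δ) ^ (-(c * δ))) :=
        Finset.prod_le_prod' hcell
    _ = ENNReal.ofReal ((k * δ) ^ (-(c * δ * r))) := by
        rw [Finset.prod_const, Nat.card_Ico, Nat.add_sub_cancel_left,
          ← ENNReal.ofReal_pow (by positivity), ← Real.rpow_natCast, ← Real.rpow_mul hk0.le,
          neg_mul]

theorem measure_iInter_compl_emptyCell_pos (hμ : Measurable μ)
    (hpos : ∀ᵐ t ∂(volume.restrict (Ioi (0 : ℝ))), 0 < μ t)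
    (hfin : ∀ t : ℝ, intensity μ (Ioo 0 t) < ⊤)
    (hN : IsPoissonProcess P N (intensity μ)) {δ : ℝ} (hδ : 0 < δ) (K : ℕ) :
    0 < P (⋂ j ∈ Finset.range K, (emptyCell N δ j)ᶜ) := by
  have hind := hN.iIndepSet_emptyCell hδ
  have : IsProbabilityMeasure P := hind.isProbabilityMeasure
  rw [(iIndepSet_iff _ _).1 hind (Finset.range K) fun j _ =>
    (MeasurableSpace.measurableSet_generateFrom (mem_singleton _)).compl, pos_iff_ne_zero, Finset.prod_ne_zero_iff]
  intro j _
  rw [Ne, prob_compl_eq_zero_iff (hN.measurableSet_emptyCell δ j), emptyCell,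
    hN.measure_count_eq_zero (measurableSet_cell δ j) (intensity_cell_ne_top hfin hδ j),
    ENNReal.ofReal_eq_one, Real.exp_eq_one_iff, neg_eq_zero]
  exact (ENNReal.toReal_pos (intensity_cell_pos hμ hpos hδ j).ne'
    (intensity_cell_ne_top hfin hδ j)).ne'

/-- If the rate is eventually at least `c * log t` with `c * ℓ > 1`, then with positive probability
no epoch is followed by a gap of length at least `ℓ`. -/
theorem measure_firstGap_eq_top_pos (hμ : Measurable μ)
    (hpos : ∀ᵐ t ∂(volume.restrict (Ioi (0 : ℝ))), 0 < μ t)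
    (hfin : ∀ t : ℝ, intensity μ (Ioo 0 t) < ⊤)
    (hN : IsPoissonProcess P N (intensity μ)) {c ℓ : ℝ} (hℓ : 0 < ℓ)
    (hcℓ : 1 < c * ℓ) (h : ∀ᶠ t in atTop, c * Real.log t ≤ μ t) :
    0 < P {ω | firstGap ℓ (N ω) = ⊤} := by
  have hc : 0 < c := pos_of_mul_pos_left (one_pos.trans hcℓ) hℓ.le
  -- Equivalent to $c\ell\,r/(r+1)>1$.
  obtain ⟨r, hr⟩ := exists_nat_gt (1 / (c * ℓ - 1))
  have hrpos : (0 : ℝ) < r := lt_trans (by have := sub_pos.2 hcℓ; positivity) hr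
  have hr1 : 0 < r := by exact_mod_cast hrpos
  rw [div_lt_iff₀ (by linarith)] at hr
  set δ := ℓ / (r + 1) with hδdef
  have hδ : 0 < δ := by positivity
  have hcδ : 1 < c * δ * r := by
    rw [hδdef, show c * (ℓ / (r + 1)) * r = c * ℓ * r / (r + 1) by ring,
      lt_div_iff₀ (by positivity)]
    linarith
  have hind := hN.iIndepSet_emptyCell hδ
  have : IsProbabilityMeasure P := hind.isProbabilityMeasure
  obtain ⟨J, hJ⟩ := summable_measure_iInter_emptyCell hfin hN hc.le hδ hcδ h
  have htail := ENNReal.tendsto_sum_nat_add _ hJ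
  obtain ⟨K₀, hK₀⟩ := (htail.eventually (gt_mem_nhds zero_lt_one)).exists
  -- The windows starting at `K` or later have total probability below $1$.
  set K := K₀ + J with hK
  set W : ℕ → Set Ω := fun i => ⋂ j ∈ Finset.Ico (i + K) (i + K + r), emptyCell N δ j with hW
  set A : Set Ω := ⋂ j ∈ Finset.range K, (emptyCell N δ j)ᶜ with hA
  set B : Set Ω := ⋂ i, (W i)ᶜ with hB
  have hBc : P Bᶜ < 1 := by
    rw [hB, compl_iInter]
    simp_rw [compl_compl]
    refine (measure_iUnion_le W).trans_lt ?_
    simpa only [hW, hK, add_assoc] using hK₀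
  -- `B` involves only cells from `K` on and `A` only earlier ones, hence they are independent.
  have hBmeas' : MeasurableSet[MeasurableSpace.generateFrom
      {t | ∃ n ∈ Ici K, emptyCell N δ n = t}] B := by
    refine MeasurableSet.iInter fun i => (MeasurableSet.compl ?_)
    refine Finset.measurableSet_biInter _ fun j hj => ?_
    exact MeasurableSpace.measurableSet_generateFrom
      ⟨j, le_trans (Nat.le_add_left _ _) (Finset.mem_Ico.1 hj).1, rfl⟩
  have hAmeas' : MeasurableSet[MeasurableSpace.generateFrom
      {t | ∃ n ∈ Iio K, emptyCell N δ n = t}] A := by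
    refine Finset.measurableSet_biInter _ fun j hj => MeasurableSet.compl ?_
    exact MeasurableSpace.measurableSet_generateFrom ⟨j, Finset.mem_range.1 hj, rfl⟩
  have hBmeas : MeasurableSet B := by
    refine MeasurableSet.iInter fun i => (MeasurableSet.compl ?_)
    exact Finset.measurableSet_biInter _ fun j _ => hN.measurableSet_emptyCell δ j
  have hBpos : P B ≠ 0 := fun h0 => hBc.ne ((prob_compl_eq_one_iff hBmeas).2 h0)
  have hApos : 0 < P A := measure_iInter_compl_emptyCell_pos hμ hpos hfin hN hδ K
  have hAB : P (A ∩ B) = P A * P B :=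
    Indep_iff _ _ P |>.1 (hind.indep_generateFrom_of_disjoint (hN.measurableSet_emptyCell δ)
      (Iio K) (Ici K) (Set.disjoint_left.2 fun n h1 h2 => not_lt.2 (mem_Ici.1 h2) (mem_Iio.1 h1))) A B hAmeas' hBmeas'
  have hABpos : 0 < P (A ∩ B) := hAB ▸ ENNReal.mul_pos hApos.ne' hBpos
  refine hABpos.trans_le (measure_mono fun ω hω => firstGap_eq_top hℓ (r := r) fun i => ?_)
  have hne : ∀ j, ω ∉ emptyCell N δ j → (N ω ∩ cell δ j).Nonempty := fun j hj =>
    nonempty_iff_ne_empty.2 fun h => hj (mem_emptyCell.2 h)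
  -- An early window already has a point in its first cell, even if it extends past `K`.
  rcases lt_or_ge i K with hi | hi
  · exact ⟨i, Finset.mem_Ico.2 ⟨le_rfl, by omega⟩,
      hne i (mem_iInter₂.1 hω.1 i (Finset.mem_range.2 hi))⟩
  · have hωW : ω ∉ W (i - K) := mem_iInter.1 hω.2 (i - K)
    simp only [hW, Nat.sub_add_cancel hi, mem_iInter, not_forall] at hωW
    obtain ⟨j, hj, hjω⟩ := hωW
    exact ⟨j, hj, hne j hjω⟩

end Asymptotics

end PoissonGap

theorem mainTheorem2 {Ω : Type*} [MeasurableSpace Ω] (P : Measure Ω) [IsProbabilityMeasure P]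
    (ℓ : ℝ) (hℓ : 0 < ℓ) (μ : ℝ → ℝ) (hμ : Measurable μ)
    (hμpos : ∀ᵐ t ∂(volume.restrict (Ioi (0 : ℝ))), 0 < μ t)
    (hμfin : ∀ t : ℝ, PoissonGap.intensity μ (Ioo 0 t) < ⊤)
    (N : Ω → Set ℝ) (hN : PoissonGap.IsPoissonProcess P N (PoissonGap.intensity μ)) :
    (limsup (fun t : ℝ => ((μ t / Real.log t : ℝ) : EReal)) atTop < ((1 / ℓ : ℝ) : EReal) →
      ∀ᵐ ω ∂P, PoissonGap.firstGap ℓ (N ω) < ⊤) ∧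
    (((1 / ℓ : ℝ) : EReal) < liminf (fun t : ℝ => ((μ t / Real.log t : ℝ) : EReal)) atTop →
      0 < P {ω | PoissonGap.firstGap ℓ (N ω) = ⊤}) := by
  constructor
  · intro h
    -- The maximum with $0$ makes $c$ positive, so that $c\log t$ is monotone.
    obtain ⟨c, hc1, hc2⟩ := EReal.lt_iff_exists_real_btwn.1
      (max_lt h (EReal.coe_lt_coe_iff.2 (one_div_pos.2 hℓ)))
    rw [max_lt_iff] at hc1
    have hc0 : 0 < c := EReal.coe_lt_coe_iff.1 hc1.2
    refine PoissonGap.ae_firstGap_lt_top hμfin hN hc0.le hℓ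
      ((lt_div_iff₀ hℓ).1 (EReal.coe_lt_coe_iff.1 hc2)) ?_
    filter_upwards [eventually_lt_of_limsup_lt hc1.1, eventually_gt_atTop 1] with t ht ht1
    exact (div_le_iff₀ (Real.log_pos ht1)).1 (EReal.coe_lt_coe_iff.1 ht).le
  · intro h
    obtain ⟨c, hc1, hc2⟩ := EReal.lt_iff_exists_real_btwn.1 h
    refine PoissonGap.measure_firstGap_eq_top_pos hμ hμpos hμfin hN (c := c) hℓ
      ((div_lt_iff₀ hℓ).1 (EReal.coe_lt_coe_iff.1 hc1)) ?_
    filter_upwards [eventually_lt_of_lt_liminf hc2, eventually_gt_atTop 1] with t ht ht1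
    exact (le_div_iff₀ (Real.log_pos ht1)).1 (EReal.coe_lt_coe_iff.1 ht).le
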